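/- In the Point–Line Incidence problem Alice holds a pair of integers $(x,y)$, Bob holds a pair of integers $(a,b)$, and they must decide whether $y = ax+b$. For a function $f\colon \mathcal X\times\mathcal Y\to\{0,1\}$ on finite sets, let $R(f)$ be its public-coin randomised communication complexity: the least $c$ for which some probability distribution over deterministic two-party protocols, each exchanging at most $c$ bits on every input, outputs $f(u,v)$ with probability at least $2/3$ on every input $(u,v)$. For $n\in\mathbb N$ and $N=2^n$ let $\mathrm{PL}_n$ be Point–Line Incidence with $(x,y)\in\{1,\dots,N\}^2$ and $(a,b)\in\{-N^2,\dots,N^2\}^2$. **Theorem.** $R(\mathrm{PL}_n)=\Omega(\log n)$ as $n\to\infty$. Together with the matching upper bound $O(\log n)$ this gives $R(\mathrm{PL}_n)=\Theta(\log n)$. The same holds when $x,y,a,b$ all range over the nonnegative $n$-bit integers $\{0,\dots,2^n-1\}$, and when they all range over the signed $n$-bit integers $\{-(2^n-1),\dots,2^n-1\}$. -/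

import Mathlib

open Filter Asymptotics

/-- A deterministic two-party communication protocol, as a binary tree. At an inner node the
player who owns it sends one bit, a function of that player's own input (the earlier messages
are recorded by the position in the tree); a leaf carries the output. -/
inductive Protocol (X Y : Type) : Type
  | output (b : Bool) : Protocol X Y
  | alice (message : X → Bool) (next : Bool → Protocol X Y) : Protocol X Y
  | bob (message : Y → Bool) (next : Bool → Protocol X Y) : Protocol X Y

namespace Protocol

variable {X Y : Type}

/-- The output of the protocol when Alice holds `x` and Bob holds `y`. -/
def run : Protocol X Y → X → Y → Bool
  | output b, _, _ => b
  | alice message next, x, y => (next (message x)).run x y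
  | bob message next, x, y => (next (message y)).run x y

/-- The cost of a protocol: its depth, the worst-case number of bits exchanged. -/
def cost : Protocol X Y → ℕ
  | output _ => 0
  | alice _ next => max (next false).cost (next true).cost + 1
  | bob _ next => max (next false).cost (next true).cost + 1

end Protocol

/-- A public-coin randomised protocol is a probability distribution over deterministic protocols.
It computes `f` within `c` bits if every protocol in its support costs at most `c` and,
on every input, the output is wrong with probability at most `1/3`. -/
def PublicCoinComputes {X Y : Type} (f : X → Y → Bool) (c : ℕ) : Prop :=
  ∃ P : PMF (Protocol X Y), (∀ π ∈ P.support, π.cost ≤ c) ∧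
    ∀ x y, P.toOuterMeasure {π | π.run x y ≠ f x y} ≤ 1 / 3

/-- The public-coin randomised communication complexity (two-sided error `1/3`) of `f`. -/
noncomputable def publicCoinCC {X Y : Type} (f : X → Y → Bool) : ℕ :=
  sInf {c : ℕ | PublicCoinComputes f c}

/-- For finitely many inputs the infimum in `publicCoinCC` is over a nonempty set. -/
theorem exists_publicCoinComputes {X Y : Type} [Finite X] (f : X → Y → Bool) :
    ∃ c, PublicCoinComputes f c := by
  classical
  have key : ∀ s : Finset X, ∃ π : Protocol X Y, ∀ x ∈ s, ∀ y, π.run x y = f x y := by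
    intro s
    induction s using Finset.induction_on with
    | empty => exact ⟨.output false, by simp⟩
    | insert a s _ ih =>
      obtain ⟨π, hπ⟩ := ih
      refine ⟨.alice (fun x => decide (x = a))
        (fun b => if b then .bob (f a) .output else π), ?_⟩
      intro x hx y
      by_cases h : x = a
      · subst h
        simp [Protocol.run]
      · simpa [Protocol.run, h] using hπ x (by simpa [h] using hx) y
  have := Fintype.ofFinite X
  obtain ⟨π, hπ⟩ := key Finset.univ
  refine ⟨π.cost, PMF.pure π, by simp, fun x y => ?_⟩
  have h : π.run x y = f x y := hπ x (Finset.mem_univ x) y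
  simp [PMF.toOuterMeasure_pure_apply, h]

/-- Point–Line Incidence: Alice holds a point `(x, y) ∈ S`, Bob holds line parameters
`(a, b) ∈ T`, and they decide whether `y = a * x + b`. -/
def pointLine (S T : Finset (ℤ × ℤ)) (p : S) (l : T) : Bool :=
  decide (p.1.2 = l.1.1 * p.1.1 + l.1.2)

/-- The pairs of integers from the interval `[u, v]`. -/
noncomputable def pairs (u v : ℤ) : Finset (ℤ × ℤ) := Finset.Icc u v ×ˢ Finset.Icc u v

/-- Point–Line Incidence with `N = 2 ^ n`, points in `{1, …, N}²` and line parameters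
in `{-N², …, N²}²`. -/
noncomputable def PL (n : ℕ) : pairs 1 (2 ^ n) → pairs (-(2 ^ n) ^ 2) ((2 ^ n) ^ 2) → Bool :=
  pointLine _ _

/-- Point–Line Incidence where all four numbers are nonnegative `n`-bit integers. -/
noncomputable def PLNat (n : ℕ) : pairs 0 (2 ^ n - 1) → pairs 0 (2 ^ n - 1) → Bool :=
  pointLine _ _

/-- Point–Line Incidence where all four numbers are `n`-bit integers with a sign. -/
noncomputable def PLSigned (n : ℕ) : pairs (-(2 ^ n - 1)) (2 ^ n - 1) → pairs (-(2 ^ n - 1)) (2 ^ n - 1) → Bool :=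
  pointLine _ _

/-! Lower bound: take slopes `x < K` and compare incident pairs, `y = a * x + b`, with their
translates by `Q = K!`. For `[0, 1]`-weights `f`, `g` on points and lines, put `F x y = f x y - f x
(y + Q)`. Cauchy–Schwarz over `(a, b)` removes `g` and leaves correlations of `F x` and `F x'`. For
`x ≠ x'`, shifting `b` by `x * a` fixes the argument of `F x` while that of `F x'` moves in steps of
`x' - x`, a divisor of `K!`; so the sum over `a` telescopes and is small. Only the diagonal matters,
and a rectangle has advantage at most `√(3K) * M * L` out of `K * M * L` (`sq_sum_rectangle_le`). A
`c`-bit protocol is a union of `2 ^ c` rectangles (`Protocol.abs_advantage_le`), so small error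
forces `K ≤ 27 * 4 ^ c`. Since `K!` fits in `n` bits for `K` of order `√n`, `c` is at least of order
`log n`. Upper bound: test the equation modulo a random prime of `O(log n)` bits. -/

/-! ### Discrepancy of rectangles. -/

/-- A finite sum over an initial segment changes by little under translation. -/
theorem abs_sum_range_sub_shift_le (φ : ℤ → ℝ) (B : ℝ) (hφ : ∀ m n, |φ m - φ n| ≤ B)
    (M : ℕ) (s : ℤ) :
    |∑ a ∈ Finset.range M, (φ a - φ (a + s))| ≤ B * |(s : ℝ)| := by
  have key : ∀ (ψ : ℤ → ℝ), (∀ m n, |ψ m - ψ n| ≤ B) → ∀ t : ℕ,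
      |∑ a ∈ Finset.range M, (ψ a - ψ (a + t))| ≤ B * t := by
    intro ψ hψ t
    induction t with
    | zero => simp
    | succ t ih =>
      -- Each further unit of translation adds a telescoping sum, hence just two boundary terms.
      have h1 : ∑ a ∈ Finset.range M, (ψ a - ψ (a + (t + 1 : ℕ)))
          = ∑ a ∈ Finset.range M, (ψ a - ψ (a + t)) + (ψ (0 + t) - ψ (M + t)) := by
        have h2 := Finset.sum_range_sub' (fun a : ℕ => ψ (a + t)) M
        simp only [Nat.cast_zero] at h2
        rw [← h2, ← Finset.sum_add_distrib]
        refine Finset.sum_congr rfl fun a _ => ?_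
        have : (a : ℤ) + (t + 1 : ℕ) = ((a + 1 : ℕ) : ℤ) + t := by push_cast; ring
        rw [this]
        ring
      rw [h1]
      refine (abs_add_le _ _).trans ?_
      have := hψ (0 + t) (M + t)
      push_cast
      linarith
  obtain ⟨t, rfl | rfl⟩ := s.eq_nat_or_neg
  · simpa using key φ hφ t
  · have h := key (fun m => φ (m + -t)) (fun m n => hφ _ _) t
    rw [← abs_neg, ← Finset.sum_neg_distrib] at h
    simpa using h

/-- Correlation bound for two distinct slopes: the difference `f' - f'(· + Q)` telescopes along
arithmetic progressions whose step divides `Q`. -/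
theorem sum_mul_shift_difference_le {K M L Q x x' : ℕ} (hx : x < K)
    {F f' : ℤ → ℝ} (hF : ∀ y, |F y| ≤ 1) (hf' : ∀ y, f' y ∈ Set.Icc (0 : ℝ) 1)
    (hne : x ≠ x') (hQ : (x' : ℤ) - x ∣ Q) :
    ∑ a ∈ Finset.range M, ∑ b ∈ Finset.range L,
      F (x * a + b) * (f' (x' * a + b) - f' (x' * a + b + Q)) ≤ 2 * K * M ^ 2 + L * Q := by
  set F' : ℤ → ℝ := fun y => f' y - f' (y + Q) with hF'def
  have hF' : ∀ y, |F' y| ≤ 1 := fun y => by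
    have h1 := hf' y
    have h2 := hf' (y + Q)
    simp only [hF'def, Set.mem_Icc] at *
    exact abs_le.2 ⟨by linarith, by linarith⟩
  -- In the coordinate `y = x * a + b` only the second factor depends on `a`.
  set ψ : ℕ → ℤ → ℝ := fun a y => F y * F' (y + (x' - x) * a) with hψdef
  have hψ : ∀ a y, |ψ a y| ≤ 1 := fun a y => by
    rw [hψdef, abs_mul]
    exact mul_le_one₀ (hF _) (abs_nonneg _) (hF' _)
  have hshift : ∀ a ∈ Finset.range M, ∑ b ∈ Finset.range L,
      F (x * a + b) * (f' (x' * a + b) - f' (x' * a + b + Q))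
        ≤ ∑ b ∈ Finset.range L, ψ a b + 2 * (K * M) := by
    intro a ha
    have h := abs_sum_range_sub_shift_le (ψ a) 2 (fun m n => by
      have h1 := abs_le.1 (hψ a m)
      have h2 := abs_le.1 (hψ a n)
      exact abs_le.2 ⟨by linarith, by linarith⟩) L (x * a)
    rw [Finset.sum_sub_distrib] at h
    have h1 := (abs_le.1 h).1
    have h2 : |((x * a : ℤ) : ℝ)| ≤ K * M := by
      rw [abs_of_nonneg (by positivity)]
      have := Finset.mem_range.1 ha
      push_cast
      gcongr
    have h3 : ∀ b : ℕ, F (x * a + b) * (f' (x' * a + b) - f' (x' * a + b + Q))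
        = ψ a (b + x * a) := fun b => by
      have e1 : (b : ℤ) + x * a = x * a + b := by ring
      have e2 : (b : ℤ) + x * a + (x' - x) * a = x' * a + b := by ring
      simp only [hψdef, hF'def, e2]
      rw [e1]
    simp only [h3]
    linarith
  have hcol : ∀ b ∈ Finset.range L, ∑ a ∈ Finset.range M, ψ a b ≤ Q := by
    intro b _
    obtain ⟨t, ht⟩ := hQ
    -- Translating by `Q` in `y` is translating by `t = Q / (x' - x)` in `a`.
    have h := abs_sum_range_sub_shift_le (fun m => f' (b + (x' - x) * m)) 1 (fun m n => by
      have h1 := hf' (b + (x' - x) * m)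
      have h2 := hf' (b + (x' - x) * n)
      simp only [Set.mem_Icc] at h1 h2
      exact abs_le.2 ⟨by linarith, by linarith⟩) M t
    have h1 : ∀ a : ℕ, ψ a b
        = F b * (f' (b + (x' - x) * a) - f' (b + (x' - x) * (a + t))) := fun a => by
      have e : (b : ℤ) + (x' - x) * (a + t) = b + (x' - x) * a + Q := by rw [ht]; ring
      simp only [hψdef, hF'def, e]
    have h2 : |(t : ℝ)| ≤ Q := by
      have h3 : |(Q : ℤ)| = |(x' : ℤ) - x| * |t| := by rw [ht, abs_mul]
      have h4 : 1 ≤ |(x' : ℤ) - x| := Int.one_le_abs (by omega)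
      have h5 : |t| ≤ (Q : ℤ) := by
        rw [Nat.abs_cast] at h3
        nlinarith [abs_nonneg t]
      exact_mod_cast h5
    simp only [h1, ← Finset.mul_sum]
    refine (le_abs_self _).trans ?_
    rw [abs_mul]
    calc _ ≤ 1 * (1 * |(t : ℝ)|) := by
          gcongr
          exact hF _
      _ ≤ Q := by simpa using h2
  calc _ ≤ ∑ a ∈ Finset.range M, (∑ b ∈ Finset.range L, ψ a b + 2 * (K * M)) :=
        Finset.sum_le_sum hshift
    _ = ∑ b ∈ Finset.range L, ∑ a ∈ Finset.range M, ψ a b + M * (2 * (K * M)) := by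
        rw [Finset.sum_add_distrib, Finset.sum_comm]
        simp
    _ ≤ ∑ b ∈ Finset.range L, (Q : ℝ) + M * (2 * (K * M)) := by
        gcongr with b hb
        exact hcol b hb
    _ = _ := by simp; ring

/-- Discrepancy of combinatorial rectangles between the incident pairs `y = a * x + b` and the
pairs `y = a * x + b + K!`, where `x < K`. -/
theorem sq_sum_rectangle_le {K Q M L : ℕ} (hQ : Q = K.factorial) (hM : M = K * Q)
    (hL : L = 2 * K ^ 2 * M) {f : ℕ → ℤ → ℝ} {g : ℕ → ℕ → ℝ}
    (hf : ∀ x y, f x y ∈ Set.Icc (0 : ℝ) 1) (hg : ∀ a b, g a b ∈ Set.Icc (0 : ℝ) 1) :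
    (∑ x ∈ Finset.range K, ∑ a ∈ Finset.range M, ∑ b ∈ Finset.range L,
      (f x (x * a + b) - f x (x * a + b + Q)) * g a b) ^ 2 ≤ 3 * K * (M * L) ^ 2 := by
  set F : ℕ → ℤ → ℝ := fun x y => f x y - f x (y + Q) with hFdef
  have hF : ∀ x y, |F x y| ≤ 1 := fun x y => by
    have h1 := hf x y
    have h2 := hf x (y + Q)
    simp only [hFdef, Set.mem_Icc] at *
    exact abs_le.2 ⟨by linarith, by linarith⟩
  set S : ℕ × ℕ → ℝ := fun i => ∑ x ∈ Finset.range K, F x (x * i.1 + i.2) with hSdef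
  set I := Finset.range M ×ˢ Finset.range L with hI
  have hsum : ∑ x ∈ Finset.range K, ∑ a ∈ Finset.range M, ∑ b ∈ Finset.range L,
      (f x (x * a + b) - f x (x * a + b + Q)) * g a b = ∑ i ∈ I, S i * g i.1 i.2 := by
    have : ∀ x : ℕ, ∑ a ∈ Finset.range M, ∑ b ∈ Finset.range L,
      (f x (x * a + b) - f x (x * a + b + Q)) * g a b
        = ∑ i ∈ I, F x (x * i.1 + i.2) * g i.1 i.2 := fun x => by
      rw [hI, Finset.sum_product]
    simp only [this]
    rw [Finset.sum_comm]
    simp only [hSdef, Finset.sum_mul]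
  have hgsq : ∑ i ∈ I, g i.1 i.2 ^ 2 ≤ M * L := by
    calc _ ≤ ∑ i ∈ I, (1 : ℝ) := by
          gcongr with i _
          have := hg i.1 i.2
          exact pow_le_one₀ this.1 this.2
      _ = _ := by simp [hI]
  have hpair : ∀ x ∈ Finset.range K, ∀ x' ∈ Finset.range K,
      ∑ i ∈ I, F x (x * i.1 + i.2) * F x' (x' * i.1 + i.2)
        ≤ (if x = x' then (M * L : ℝ) else 0) + (2 * K * M ^ 2 + L * Q) := by
    intro x hx x' hx'
    have hxK := Finset.mem_range.1 hx
    have hxK' := Finset.mem_range.1 hx'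
    split_ifs with h
    · have : ∑ i ∈ I, F x (x * i.1 + i.2) * F x' (x' * i.1 + i.2) ≤ ∑ i ∈ I, (1 : ℝ) := by
        gcongr with i _
        refine (le_abs_self _).trans ?_
        rw [abs_mul]
        exact mul_le_one₀ (hF _ _) (abs_nonneg _) (hF _ _)
      have h2 : ∑ i ∈ I, (1 : ℝ) = M * L := by simp [hI]
      have : (0 : ℝ) ≤ 2 * K * M ^ 2 + L * Q := by positivity
      linarith
    · rw [zero_add, hI, Finset.sum_product]
      refine sum_mul_shift_difference_le hxK (hF x) (hf x') h ?_
      rw [← Int.natAbs_dvd_natAbs, Int.natAbs_natCast, hQ]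
      exact Nat.dvd_factorial (by omega) (by omega)
  have hSsq : ∑ i ∈ I, S i ^ 2 ≤ 3 * K * (M * L) := by
    have h1 : ∑ i ∈ I, S i ^ 2 = ∑ x ∈ Finset.range K, ∑ x' ∈ Finset.range K,
        ∑ i ∈ I, F x (x * i.1 + i.2) * F x' (x' * i.1 + i.2) := by
      simp only [hSdef, sq, Finset.sum_mul_sum]
      rw [Finset.sum_comm]
      exact Finset.sum_congr rfl fun x _ => Finset.sum_comm
    rw [h1]
    calc _ ≤ ∑ x ∈ Finset.range K, ∑ x' ∈ Finset.range K,
          ((if x = x' then (M * L : ℝ) else 0) + (2 * K * M ^ 2 + L * Q)) :=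
          Finset.sum_le_sum fun x hx => Finset.sum_le_sum fun x' hx' => hpair x hx x' hx'
      _ = ∑ x ∈ Finset.range K, ((M * L : ℝ) + K * (2 * K * M ^ 2 + L * Q)) := by
          refine Finset.sum_congr rfl fun x hx => ?_
          rw [Finset.sum_add_distrib, Finset.sum_ite_eq, if_pos hx, Finset.sum_const,
            Finset.card_range, nsmul_eq_mul]
      -- `M` and `L` are chosen so that `2 * K * M ^ 2` and `L * Q` both equal `M * L / K`: the
      -- off-diagonal bounds total `2 * K * M * L`, the diagonal `K * M * L`.
      _ = 3 * K * (M * L) := by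
          simp only [Finset.sum_const, Finset.card_range, nsmul_eq_mul, hL, hM]
          push_cast
          ring
  rw [hsum]
  calc _ ≤ (∑ i ∈ I, S i ^ 2) * ∑ i ∈ I, g i.1 i.2 ^ 2 := Finset.sum_mul_sq_le_sq_mul_sq _ _ _
    _ ≤ (3 * K * (M * L)) * (M * L) := by
        gcongr
    _ = _ := by ring

/-! ### Deterministic protocols. -/

namespace Protocol

variable {X Y X' Y' : Type}

/-- Run a protocol after the players have translated their inputs. -/
def comap (φ : X' → X) (ψ : Y' → Y) : Protocol X Y → Protocol X' Y'
  | output b => output b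
  | alice m next => alice (m ∘ φ) fun b => (next b).comap φ ψ
  | bob m next => bob (m ∘ ψ) fun b => (next b).comap φ ψ

theorem run_comap (φ : X' → X) (ψ : Y' → Y) (π : Protocol X Y) (x : X') (y : Y') :
    (π.comap φ ψ).run x y = π.run (φ x) (ψ y) := by
  induction π with
  | output b => rfl
  | alice m next ih => exact ih _
  | bob m next ih => exact ih _

theorem cost_comap (φ : X' → X) (ψ : Y' → Y) (π : Protocol X Y) :
    (π.comap φ ψ).cost = π.cost := by
  induction π with
  | output b => rfl
  | alice m next ih => simp [comap, cost, ih]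
  | bob m next ih => simp [comap, cost, ih]

/-- A protocol distinguishes two families of inputs with the same second components at most
`2 ^ cost` times as well as a rectangle does. -/
theorem abs_advantage_le {ι : Type} (s : Finset ι) (p p' : ι → X) (q : ι → Y) {B : ℝ}
    (hB : ∀ (u : X → ℝ) (v : Y → ℝ), (∀ x, u x ∈ Set.Icc (0 : ℝ) 1) →
      (∀ y, v y ∈ Set.Icc (0 : ℝ) 1) → |∑ i ∈ s, (u (p i) - u (p' i)) * v (q i)| ≤ B)
    (π : Protocol X Y) (u : X → ℝ) (v : Y → ℝ) (hu : ∀ x, u x ∈ Set.Icc (0 : ℝ) 1)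
    (hv : ∀ y, v y ∈ Set.Icc (0 : ℝ) 1) :
    |∑ i ∈ s, (u (p i) * (if π.run (p i) (q i) then 1 else 0)
      - u (p' i) * (if π.run (p' i) (q i) then 1 else 0)) * v (q i)| ≤ 2 ^ π.cost * B := by
  have hB0 : 0 ≤ B := (abs_nonneg _).trans (hB u v hu hv)
  have hrestrict : ∀ {Z : Type} (w : Z → ℝ) (m : Z → Bool) (b : Bool),
      (∀ z, w z ∈ Set.Icc (0 : ℝ) 1) →
      ∀ z, (if m z = b then w z else 0) ∈ Set.Icc (0 : ℝ) 1 := by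
    intro Z w m b hw z
    split_ifs
    · exact hw z
    · simp
  have hcombine : ∀ {d e : ℕ} {s t : ℝ}, |s| ≤ 2 ^ d * B → |t| ≤ 2 ^ e * B →
      |s + t| ≤ 2 ^ (max d e + 1) * B := by
    intro d e s t hs ht
    have h1 : (2 : ℝ) ^ d ≤ 2 ^ max d e := pow_le_pow_right₀ (by norm_num) (le_max_left _ _)
    have h2 : (2 : ℝ) ^ e ≤ 2 ^ max d e := pow_le_pow_right₀ (by norm_num) (le_max_right _ _)
    calc _ ≤ |s| + |t| := abs_add_le _ _
      _ ≤ 2 ^ max d e * B + 2 ^ max d e * B :=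
          add_le_add (hs.trans (by gcongr)) (ht.trans (by gcongr))
      _ = _ := by ring
  -- The weights record the rectangle reached so far; each message cuts one of them in two.
  induction π generalizing u v with
  | output b =>
    cases b
    · simpa [run, cost] using hB0
    · simpa [run, cost] using hB u v hu hv
  | alice m next ih =>
    have h := hcombine (ih false _ v (hrestrict u m false hu) hv)
      (ih true _ v (hrestrict u m true hu) hv)
    rw [← Finset.sum_add_distrib] at h
    refine le_of_eq_of_le (congrArg _ (Finset.sum_congr rfl fun i _ => ?_)) h
    cases h1 : m (p i) <;> cases h2 : m (p' i) <;> simp [run, h1, h2, -mul_ite] <;> ring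
  | bob m next ih =>
    have h := hcombine (ih false u _ hu (hrestrict v m false hv))
      (ih true u _ hu (hrestrict v m true hv))
    rw [← Finset.sum_add_distrib] at h
    refine le_of_eq_of_le (congrArg _ (Finset.sum_congr rfl fun i _ => ?_)) h
    cases h1 : m (q i) <;> simp [run, h1]

/-- Alice can send a number below `2 ^ k` in `k` bits. -/
theorem exists_send {k d : ℕ} (α : X → ℕ) (hα : ∀ x, α x < 2 ^ k) (next : ℕ → Protocol X Y)
    (hnext : ∀ m, (next m).cost ≤ d) :
    ∃ π : Protocol X Y, π.cost ≤ k + d ∧ ∀ x y, π.run x y = (next (α x)).run x y := by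
  induction k generalizing α next with
  | zero =>
    refine ⟨next 0, by simpa using hnext 0, fun x y => ?_⟩
    have : α x = 0 := by simpa using hα x
    rw [this]
  | succ k ih =>
    have h := fun b : Bool => ih (fun x => α x / 2) (fun x => by have := hα x; omega)
      -- The lowest bit is sent first and restored here.
      (fun m => next (2 * m + b.toNat)) (fun m => hnext _)
    choose σ hσ hrun using h
    refine ⟨alice (fun x => α x % 2 == 1) σ, ?_, fun x y => ?_⟩
    · have := hσ false
      have := hσ true
      simp only [cost]
      omega
    · simp only [run, hrun]
      congr
      rcases Nat.mod_two_eq_zero_or_one (α x) with h | h <;> simp [h] <;> omega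

end Protocol

/-! ### Randomised protocols and averaging. -/

section

variable {X Y X' Y' : Type}

theorem PublicCoinComputes.comap {f : X → Y → Bool} {c : ℕ} (h : PublicCoinComputes f c)
    (φ : X' → X) (ψ : Y' → Y) : PublicCoinComputes (fun x y => f (φ x) (ψ y)) c := by
  obtain ⟨P, hc, herr⟩ := h
  refine ⟨P.map (Protocol.comap φ ψ), fun π hπ => ?_, fun x y => ?_⟩
  · rw [PMF.support_map] at hπ
    obtain ⟨σ, hσ, rfl⟩ := hπ
    rw [Protocol.cost_comap]
    exact hc σ hσ
  · rw [PMF.toOuterMeasure_map_apply]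
    simpa [Set.preimage, Protocol.run_comap] using herr (φ x) (ψ y)

theorem publicCoinComputes_publicCoinCC [Finite X] (f : X → Y → Bool) :
    PublicCoinComputes f (publicCoinCC f) :=
  Nat.sInf_mem (exists_publicCoinComputes f)

theorem publicCoinCC_le {f : X → Y → Bool} {c : ℕ} (h : PublicCoinComputes f c) :
    publicCoinCC f ≤ c :=
  Nat.sInf_le h

/-- Some protocol in the support errs on at most a third of any finite family of inputs. -/
theorem PublicCoinComputes.exists_card_errors_le {f : X → Y → Bool} {c : ℕ}
    (h : PublicCoinComputes f c) {ι : Type} (s : Finset ι) (p : ι → X) (q : ι → Y) :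
    ∃ π : Protocol X Y, π.cost ≤ c ∧
      3 * (s.filter fun i => π.run (p i) (q i) ≠ f (p i) (q i)).card ≤ s.card := by
  classical
  obtain ⟨P, hc, herr⟩ := h
  by_contra! hcon
  set E : Protocol X Y → ℕ :=
    fun π => (s.filter fun i => π.run (p i) (q i) ≠ f (p i) (q i)).card with hE
  have h1 : ∑' π, P π * (3 * E π) ≤ s.card := by
    have h2 : ∀ π, P π * (3 * E π) = ∑ i ∈ s,
        3 * Set.indicator {π | π.run (p i) (q i) ≠ f (p i) (q i)} P π := by
      intro π
      simp only [hE, Finset.card_filter, ← Finset.mul_sum, Nat.cast_sum, Set.indicator_apply,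
        Set.mem_ofPred_eq, Nat.cast_ite, Nat.cast_one, Nat.cast_zero]
      rw [mul_left_comm, Finset.mul_sum]
      simp
    simp only [h2]
    rw [Summable.tsum_finsetSum fun _ _ => ENNReal.summable]
    simp only [ENNReal.tsum_mul_left, ← PMF.toOuterMeasure_apply]
    calc _ ≤ ∑ i ∈ s, 3 * (1 / 3 : ENNReal) := by
          gcongr with i _
          exact herr (p i) (q i)
      _ = s.card := by
          rw [ENNReal.mul_div_cancel (by norm_num) (by norm_num)]
          simp
  obtain ⟨π₀, hπ₀⟩ := P.support_nonempty
  -- If every protocol in the support erred on more than a third of `s`, so would the average;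
  -- strictness comes from one `π₀` of positive mass.
  have h3 : ∑' π, P π * s.card < ∑' π, P π * (3 * E π) := by
    refine ENNReal.tsum_lt_tsum (i := π₀) ?_ (fun π => ?_) ?_
    · rw [ENNReal.tsum_mul_right, P.tsum_coe]
      simp
    · by_cases hπ : π ∈ P.support
      · gcongr
        exact_mod_cast (hcon π (hc π hπ)).le
      · simp [(P.apply_eq_zero_iff π).2 hπ]
    · refine ENNReal.mul_lt_mul_right ((P.mem_support_iff π₀).1 hπ₀) (P.apply_ne_top π₀) ?_
      exact_mod_cast hcon π₀ (hc π₀ hπ₀)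
  rw [ENNReal.tsum_mul_right, P.tsum_coe, one_mul] at h3
  exact absurd h1 (not_le.2 h3)

end

/-! ### The logarithmic lower bound. -/

/-- Lower bound for any function that accepts the incident pairs of a thin grid and rejects their
vertical translates by `K!`. -/
theorem le_four_pow_of_publicCoinComputes {K Q M L c : ℕ} (hK : 0 < K) (hQ : Q = K.factorial)
    (hM : M = K * Q) (hL : L = 2 * K ^ 2 * M) {F : ℕ × ℤ → ℕ × ℕ → Bool}
    (hF₁ : ∀ x < K, ∀ a < M, ∀ b < L, F (x, x * a + b) (a, b) = true)
    (hF₀ : ∀ x < K, ∀ a < M, ∀ b < L, F (x, x * a + b + Q) (a, b) = false)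
    (h : PublicCoinComputes F c) : K ≤ 27 * 4 ^ c := by
  classical
  set I := Finset.range K ×ˢ Finset.range M ×ˢ Finset.range L with hI
  set p : ℕ × ℕ × ℕ → ℕ × ℤ := fun i => (i.1, i.1 * i.2.1 + i.2.2) with hp
  set p' : ℕ × ℕ × ℕ → ℕ × ℤ := fun i => (i.1, i.1 * i.2.1 + i.2.2 + Q) with hp'
  set q : ℕ × ℕ × ℕ → ℕ × ℕ := fun i => i.2 with hq
  have hQ0 : 0 < Q := hQ ▸ K.factorial_pos
  have hM0 : 0 < M := by rw [hM]; positivity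
  have hL0 : 0 < L := by rw [hL]; positivity
  set B : ℝ := √(3 * K) * (M * L) with hBdef
  have hB : ∀ (u : ℕ × ℤ → ℝ) (v : ℕ × ℕ → ℝ), (∀ x, u x ∈ Set.Icc (0 : ℝ) 1) →
      (∀ y, v y ∈ Set.Icc (0 : ℝ) 1) → |∑ i ∈ I, (u (p i) - u (p' i)) * v (q i)| ≤ B := by
    intro u v hu hv
    have h1 := sq_sum_rectangle_le hQ hM hL (f := fun x y => u (x, y)) (g := fun a b => v (a, b))
      (fun _ _ => hu _) (fun _ _ => hv _)
    have h2 : ∑ i ∈ I, (u (p i) - u (p' i)) * v (q i) = ∑ x ∈ Finset.range K,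
        ∑ a ∈ Finset.range M, ∑ b ∈ Finset.range L,
          (u (x, x * a + b) - u (x, x * a + b + Q)) * v (a, b) := by
      rw [hI, Finset.sum_product]
      exact Finset.sum_congr rfl fun x _ => Finset.sum_product _ _ _
    rw [h2]
    refine abs_le_of_sq_le_sq (h1.trans_eq ?_) (by positivity)
    rw [hBdef, mul_pow √_, Real.sq_sqrt (by positivity)]
  -- The Boolean selects the incident pair or its translate: at most `2 * I.card / 3` errors, so an
  -- acceptance gap of at least `I.card / 3`.
  obtain ⟨π, hπ, herr⟩ := h.exists_card_errors_le (I ×ˢ (Finset.univ : Finset Bool))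
    (fun i => if i.2 then p i.1 else p' i.1) (fun i => q i.1)
  have hadv := Protocol.abs_advantage_le I p p' q hB π (fun _ => 1) (fun _ => 1) (by simp)
    (by simp)
  have hval : ∀ i ∈ I, F (p i) (q i) = true ∧ F (p' i) (q i) = false := by
    rintro ⟨x, a, b⟩ hi
    simp only [hI, Finset.mem_product, Finset.mem_range] at hi
    exact ⟨hF₁ x hi.1 a hi.2.1 b hi.2.2, hF₀ x hi.1 a hi.2.1 b hi.2.2⟩
  have hIcard : (I.card : ℝ) = K * (M * L) := by simp [hI]
  have herr' : 3 * ∑ i ∈ I, ((if π.run (p i) (q i) then (0 : ℝ) else 1)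
      + (if π.run (p' i) (q i) then 1 else 0)) ≤ 2 * I.card := by
    have h1 : (((I ×ˢ (Finset.univ : Finset Bool)).filter fun i =>
        π.run (if i.2 then p i.1 else p' i.1) (q i.1)
          ≠ F (if i.2 then p i.1 else p' i.1) (q i.1)).card : ℝ)
        = ∑ i ∈ I, ((if π.run (p i) (q i) then (0 : ℝ) else 1)
          + (if π.run (p' i) (q i) then 1 else 0)) := by
      rw [Finset.card_filter, Finset.sum_product]
      push_cast
      refine Finset.sum_congr rfl fun i hi => ?_
      obtain ⟨h1, h2⟩ := hval i hi
      cases h3 : π.run (p i) (q i) <;> cases h4 : π.run (p' i) (q i) <;>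
        simp [h1, h2, h3, h4]
    have h2 : (3 * ((I ×ˢ (Finset.univ : Finset Bool)).filter fun i =>
        π.run (if i.2 then p i.1 else p' i.1) (q i.1)
          ≠ F (if i.2 then p i.1 else p' i.1) (q i.1)).card : ℝ)
        ≤ ((I ×ˢ (Finset.univ : Finset Bool)).card : ℝ) := by exact_mod_cast herr
    rw [h1] at h2
    simpa [mul_comm] using h2
  have hgap : (I.card : ℝ) / 3 ≤ 2 ^ π.cost * B := by
    refine le_trans ?_ ((le_abs_self _).trans hadv)
    have h1 : ∑ i ∈ I, ((1 : ℝ) * (if π.run (p i) (q i) then 1 else 0)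
        - 1 * (if π.run (p' i) (q i) then 1 else 0)) * 1
        = I.card - ∑ i ∈ I, ((if π.run (p i) (q i) then (0 : ℝ) else 1)
          + (if π.run (p' i) (q i) then 1 else 0)) := by
      rw [Finset.card_eq_sum_ones, Nat.cast_sum, ← Finset.sum_sub_distrib]
      refine Finset.sum_congr rfl fun i _ => ?_
      cases π.run (p i) (q i) <;> cases π.run (p' i) (q i) <;> simp
    linarith
  have hML : (0 : ℝ) < M * L := by positivity
  have h1 : (K : ℝ) ≤ 3 * 2 ^ c * √(3 * K) := by
    have h2 : (2 : ℝ) ^ π.cost ≤ 2 ^ c := pow_le_pow_right₀ (by norm_num) hπ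
    have h3 : (I.card : ℝ) / 3 ≤ 2 ^ c * B := hgap.trans (by gcongr)
    rw [hIcard, hBdef] at h3
    refine le_of_mul_le_mul_right ?_ hML
    linarith
  have h2 : (K : ℝ) * K ≤ 27 * 4 ^ c * K := by
    have h3 : (K : ℝ) * K ≤ (3 * 2 ^ c * √(3 * K)) * (3 * 2 ^ c * √(3 * K)) := by gcongr
    have h4 : √(3 * (K : ℝ)) * √(3 * K) = 3 * K := Real.mul_self_sqrt (by positivity)
    have h5 : (4 : ℝ) ^ c = 2 ^ c * 2 ^ c := by rw [← mul_pow]; norm_num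
    calc _ ≤ _ := h3
      _ = 9 * (2 ^ c * 2 ^ c) * (√(3 * K) * √(3 * K)) := by ring
      _ = _ := by rw [h4, h5]; ring
  have h3 := le_of_mul_le_mul_right h2 (by positivity)
  exact_mod_cast h3

theorem mem_pairs {u v : ℤ} {p : ℤ × ℤ} :
    p ∈ pairs u v ↔ (u ≤ p.1 ∧ p.1 ≤ v) ∧ u ≤ p.2 ∧ p.2 ≤ v := by
  simp [pairs]

/-- With `K = 2 ^ k`, all numbers in the grid are at most `4 * K ^ (K + 3) = 2 ^ (2 + k * (K + 3))`,
and this exponent is at most `8 * K ^ 2 = 8 * 4 ^ k`. -/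
theorem two_pow_le_of_PLNat {n k c : ℕ} (hk : 8 * 4 ^ k ≤ n) (h : PublicCoinComputes (PLNat n) c) :
    2 ^ k ≤ 27 * 4 ^ c := by
  classical
  set K := 2 ^ k with hKdef
  set Q := K.factorial with hQ
  set M := K * Q with hM
  set L := 2 * K ^ 2 * M with hL
  have hK : 0 < K := by positivity
  have hQ0 : 0 < Q := K.factorial_pos
  have hbound : K * M + L + Q ≤ 2 ^ n := by
    have h1 : Q ≤ K ^ K := K.factorial_le_pow
    have h2 : K * M + L + Q ≤ 4 * K ^ 3 * Q := by
      rw [hL, hM]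
      have h3 : K ^ 2 ≤ K ^ 3 := Nat.pow_le_pow_right hK (by norm_num)
      have h4 : 1 ≤ K ^ 3 := Nat.one_le_pow _ _ hK
      nlinarith [Nat.mul_le_mul_right Q h3, Nat.mul_le_mul_right Q h4]
    calc _ ≤ 4 * K ^ 3 * Q := h2
      _ ≤ 4 * K ^ 3 * K ^ K := by gcongr
      _ = 2 ^ (2 + k * (3 + K)) := by
          rw [mul_assoc, ← pow_add, hKdef, ← pow_mul, pow_add 2 2]
          norm_num
      _ ≤ 2 ^ n := by
          refine Nat.pow_le_pow_right (by norm_num) (le_trans ?_ hk)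
          have h3 : k ≤ K := Nat.lt_two_pow_self.le
          have h4 : 4 ^ k = K * K := by rw [hKdef, ← mul_pow]; norm_num
          rw [h4]
          nlinarith [Nat.mul_le_mul_right (3 + K) h3]
  have hpos : (0 : ℤ) ≤ 2 ^ n - 1 := by
    have : (1 : ℤ) ≤ 2 ^ n := one_le_pow₀ (by norm_num)
    linarith
  have hbound' : (K : ℤ) * M + L + Q ≤ 2 ^ n := by exact_mod_cast hbound
  have hzero : ((0, 0) : ℤ × ℤ) ∈ pairs 0 (2 ^ n - 1) := mem_pairs.2 ⟨⟨le_rfl, hpos⟩, le_rfl, hpos⟩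
  -- Out-of-range inputs go to the dummy `(0, 0)`; the hard inputs are all in range.
  let clamp : ℤ × ℤ → pairs 0 (2 ^ n - 1) := fun r => if hr : r ∈ pairs 0 (2 ^ n - 1) then
    ⟨r, hr⟩ else ⟨(0, 0), hzero⟩
  have hclamp : ∀ r ∈ pairs 0 (2 ^ n - 1), (clamp r).1 = r := fun r hr => by simp [clamp, hr]
  have hmem : ∀ x < K, ∀ a < M, ∀ b < L, ∀ z ≤ Q,
      ((x : ℤ), (x * a + b + z : ℤ)) ∈ pairs 0 (2 ^ n - 1) ∧
      ((a : ℤ), (b : ℤ)) ∈ pairs 0 (2 ^ n - 1) := by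
    intro x hx a ha b hb z hz
    have h1 : x * a + b + z < 2 ^ n := by
      have : x * a ≤ K * M := by gcongr
      omega
    have hM0 : 0 < M := by positivity
    have h2 : x < 2 ^ n := by
      have : K * 1 ≤ K * M := Nat.mul_le_mul_left _ hM0
      omega
    have h3 : a < 2 ^ n := by
      have : 1 * M ≤ K * M := Nat.mul_le_mul_right _ hK
      omega
    have h4 : b < 2 ^ n := by omega
    zify at h1 h2 h3 h4
    simp only [mem_pairs]
    refine ⟨⟨⟨?_, ?_⟩, ?_, ?_⟩, ⟨?_, ?_⟩, ?_, ?_⟩ <;> first | positivity | linarith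
  refine le_four_pow_of_publicCoinComputes hK hQ hM hL (F := fun p l =>
    PLNat n (clamp (p.1, p.2)) (clamp (l.1, l.2))) (fun x hx a ha b hb => ?_)
    (fun x hx a ha b hb => ?_)
    (h.comap (fun p : ℕ × ℤ => clamp (p.1, p.2)) (fun l : ℕ × ℕ => clamp (l.1, l.2)))
  · obtain ⟨h1, h2⟩ := hmem x hx a ha b hb 0 (by omega)
    rw [Nat.cast_zero, add_zero] at h1
    simp only [PLNat, pointLine, hclamp _ h1, hclamp _ h2]
    simp [mul_comm]
  · obtain ⟨h1, h2⟩ := hmem x hx a ha b hb Q le_rfl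
    simp only [PLNat, pointLine, hclamp _ h1, hclamp _ h2]
    simp [mul_comm, hQ0.ne']

theorem log_le_of_PLNat {n c : ℕ} (hn : 8 ≤ n) (h : PublicCoinComputes (PLNat n) c) :
    Real.log n ≤ 4 * c + 15 := by
  set k := Nat.log 4 (n / 8) with hk
  have h1 : 4 ^ k ≤ n / 8 := Nat.pow_log_le_self 4 (by omega)
  have h2 : n / 8 < 4 ^ (k + 1) := Nat.lt_pow_succ_log_self (by norm_num) _
  have h3 : 2 ^ k ≤ 27 * 4 ^ c := two_pow_le_of_PLNat (by omega) h
  -- `27 < 2 ^ 5`.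
  have h4 : k < 2 * c + 5 := by
    refine (Nat.pow_lt_pow_iff_right (a := 2) (by norm_num)).1 (h3.trans_lt ?_)
    rw [pow_add, pow_mul]
    have : 0 < 4 ^ c := by positivity
    norm_num
    omega
  have h5 : n ≤ 2 ^ (2 * k + 5) := by
    have : 2 ^ (2 * k + 5) = 8 * 4 ^ (k + 1) := by
      rw [pow_add, pow_mul, pow_succ 4]; norm_num; ring
    omega
  calc Real.log n ≤ Real.log (2 ^ (2 * k + 5)) := by
        apply Real.log_le_log (by positivity)
        exact_mod_cast h5
    _ = (2 * k + 5) * Real.log 2 := by rw [Real.log_pow]; push_cast; ring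
    _ ≤ (2 * k + 5) * 1 := by
        gcongr
        linarith [Real.log_two_lt_d9]
    _ ≤ 4 * c + 15 := by
        have : (k : ℝ) + 1 ≤ 2 * c + 5 := by exact_mod_cast h4
        linarith

theorem PLNat_of_PLSigned {n c : ℕ} (h : PublicCoinComputes (PLSigned n) c) :
    PublicCoinComputes (PLNat n) c := by
  have hmem : ∀ r : pairs 0 (2 ^ n - 1), r.1 ∈ pairs (-(2 ^ n - 1)) (2 ^ n - 1) := by
    rintro ⟨r, hr⟩
    simp only [mem_pairs] at hr ⊢
    omega
  have h' := h.comap (fun r => (⟨r.1, hmem r⟩ : pairs (-(2 ^ n - 1)) (2 ^ n - 1)))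
    (fun r => (⟨r.1, hmem r⟩ : pairs (-(2 ^ n - 1)) (2 ^ n - 1)))
  convert h' using 3 with p l
  simp only [PLSigned, PLNat, pointLine]

/-- Moving the point by `(1, 1)` is matched by the intercept `b - a + 1`, because `a * (x + 1) + (b
- a + 1) = a * x + b + 1`. -/
theorem PLNat_of_PL {n c : ℕ} (h : PublicCoinComputes (PL n) c) :
    PublicCoinComputes (PLNat n) c := by
  have hpoint : ∀ r : pairs 0 (2 ^ n - 1), (r.1.1 + 1, r.1.2 + 1) ∈ pairs 1 (2 ^ n) := by
    rintro ⟨r, hr⟩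
    simp only [mem_pairs] at hr ⊢
    omega
  have hline : ∀ r : pairs 0 (2 ^ n - 1),
      (r.1.1, r.1.2 - r.1.1 + 1) ∈ pairs (-(2 ^ n) ^ 2) ((2 ^ n) ^ 2) := by
    rintro ⟨r, hr⟩
    have h1 : (1 : ℤ) ≤ 2 ^ n := one_le_pow₀ (by norm_num)
    have h2 : (2 : ℤ) ^ n ≤ (2 ^ n) ^ 2 := by nlinarith
    simp only [mem_pairs] at hr ⊢
    omega
  convert h.comap (fun r => ⟨_, hpoint r⟩) (fun r => ⟨_, hline r⟩) using 3 with p l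
  simp only [PLNat, PL, pointLine, decide_eq_decide]
  constructor <;> intro h <;> linarith

/-! ### The upper bound by fingerprinting. -/

/-- Chebyshev's bounds on `ψ` give `4 ^ j ≤ 2 * j * P + (2 * j + 1)` for the number `P` of primes;
this square-root consequence suffices for fingerprinting. -/
theorem two_pow_le_card_primesLE_four_pow {j : ℕ} (hj : 0 < j) :
    2 ^ j ≤ (Nat.primesLE (4 ^ j)).card + 2 := by
  have h1 := (Chebyshev.psi_ge (4 ^ j)).trans (Chebyshev.psi_le_primeCounting_mul_log (4 ^ j))
  rw [← Nat.primesLE_card_eq_primeCounting] at h1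
  set P := (Nat.primesLE (4 ^ j)).card
  have hl2 : 0 < Real.log 2 := Real.log_pos (by norm_num)
  have h2 : Real.log ((4 ^ j : ℕ) : ℝ) = 2 * j * Real.log 2 := by
    rw [Nat.cast_pow, Real.log_pow, show ((4 : ℕ) : ℝ) = 2 ^ 2 by norm_num, Real.log_pow]
    push_cast
    ring
  have h3 : Real.log (((4 ^ j : ℕ) : ℝ) + 1) ≤ (2 * j + 1) * Real.log 2 := by
    have h4 : ((4 ^ j : ℕ) : ℝ) + 1 ≤ 2 * (4 ^ j : ℕ) := by
      have : (1 : ℝ) ≤ (4 ^ j : ℕ) := by exact_mod_cast Nat.one_le_pow _ _ (by norm_num)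
      linarith
    calc _ ≤ Real.log (2 * ((4 ^ j : ℕ) : ℝ)) := Real.log_le_log (by positivity) h4
      _ = _ := by
        rw [Real.log_mul (by norm_num) (by positivity), h2]
        ring
  rw [h2] at h1
  have h4 : ((4 ^ j : ℕ) : ℝ) ≤ 2 * j * P + (2 * j + 1) := by
    refine le_of_mul_le_mul_right ?_ hl2
    nlinarith
  have h5 : 4 ^ j ≤ 2 * j * P + (2 * j + 1) := by exact_mod_cast h4
  have h6 : 4 ^ j = 2 ^ j * 2 ^ j := by rw [← mul_pow]; norm_num
  have h7 : 2 * j ≤ 2 ^ j := by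
    obtain ⟨i, rfl⟩ : ∃ i, j = i + 1 := ⟨j - 1, by omega⟩
    have := Nat.lt_two_pow_self (n := i)
    rw [pow_succ]
    omega
  by_contra! hcon
  have h8 : 2 * j * (P + 3) ≤ 2 ^ j * 2 ^ j := Nat.mul_le_mul h7 (by omega)
  nlinarith

theorem two_pow_card_primeFactors_le {z : ℕ} (hz : z ≠ 0) : 2 ^ z.primeFactors.card ≤ z := by
  calc _ ≤ ∏ p ∈ z.primeFactors, p :=
        Finset.pow_card_le_prod _ _ _ fun p hp => (Nat.prime_of_mem_primeFactors hp).two_le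
    _ ≤ z := Nat.le_of_dvd (Nat.pos_of_ne_zero hz) z.prod_primeFactors_dvd

/-- Checking the incidence modulo a prime `p ≤ 4 ^ j` takes `4 * j + 1` bits. -/
theorem exists_protocol_modEq (S T : Finset (ℤ × ℤ)) {j p : ℕ} (hp : 0 < p) (hpj : p ≤ 4 ^ j) :
    ∃ π : Protocol S T, π.cost ≤ 4 * j + 1 ∧ ∀ r l,
      π.run r l = decide ((p : ℤ) ∣ r.1.2 - (l.1.1 * r.1.1 + l.1.2)) := by
  have hres : ∀ z : ℤ, (z % p).toNat < 2 ^ (2 * j) := fun z => by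
    have h1 := Int.emod_lt_of_pos z (Int.natCast_pos.2 hp)
    have h2 := Int.emod_nonneg z (Int.natCast_pos.2 hp).ne'
    have h3 : 2 ^ (2 * j) = 4 ^ j := by rw [pow_mul]; norm_num
    omega
  have hcast : ∀ z : ℤ, ((z % p).toNat : ℤ) = z % p := fun z =>
    Int.toNat_of_nonneg (Int.emod_nonneg z (Int.natCast_pos.2 hp).ne')
  -- Alice sends `x % p`, then `y % p`, in `2 * j` bits each; Bob answers with one bit.
  have hinner := fun s : ℕ => Protocol.exists_send (fun r : S => (r.1.2 % p).toNat)
    (fun r => hres _) (fun t : ℕ => (Protocol.bob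
      (fun l : T => decide ((p : ℤ) ∣ t - (l.1.1 * s + l.1.2))) Protocol.output : Protocol S T))
    (d := 1) (fun t => by simp [Protocol.cost])
  choose σ hσ hrun using hinner
  obtain ⟨π, hπ, hπrun⟩ := Protocol.exists_send (fun r : S => (r.1.1 % p).toNat)
    (fun r => hres _) σ hσ
  refine ⟨π, by omega, fun r l => ?_⟩
  rw [hπrun, hrun]
  simp only [Protocol.run, decide_eq_decide, hcast]
  rw [← Int.modEq_iff_dvd, ← Int.modEq_iff_dvd]
  have h1 : l.1.1 * (r.1.1 % p) + l.1.2 ≡ l.1.1 * r.1.1 + l.1.2 [ZMOD p] :=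
    ((Int.mod_modEq _ _).mul_left _).add_right _
  exact ⟨fun h => h1.symm.trans (h.trans (Int.mod_modEq _ _)),
    fun h => h1.trans (h.trans (Int.mod_modEq _ _).symm)⟩

/-- Fingerprinting modulo a random prime. -/
theorem publicCoinComputes_pointLine {S T : Finset (ℤ × ℤ)} {m j : ℕ} (hj : 3 * m + 5 ≤ 2 ^ j)
    (hST : ∀ p ∈ S, ∀ l ∈ T, |p.2 - (l.1 * p.1 + l.2)| < 2 ^ m) :
    PublicCoinComputes (pointLine S T) (4 * j + 1) := by
  classical
  set R := Nat.primesLE (4 ^ j) with hR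
  have hj0 : 0 < j := by
    rcases Nat.eq_zero_or_pos j with rfl | h
    · rw [pow_zero] at hj
      omega
    · exact h
  have hcard := two_pow_le_card_primesLE_four_pow hj0
  rw [← hR] at hcard
  have hne : R.Nonempty := Finset.card_pos.1 (by omega)
  have hprot : ∀ p : ℕ, ∃ π : Protocol S T, π.cost ≤ 4 * j + 1 ∧ (p ∈ R → ∀ r l,
      π.run r l = decide ((p : ℤ) ∣ r.1.2 - (l.1.1 * r.1.1 + l.1.2))) := by
    intro p
    by_cases hp : p ∈ R
    · obtain ⟨h1, h2⟩ := Nat.mem_primesLE.1 hp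
      obtain ⟨π, hπ, hrun⟩ := exists_protocol_modEq S T h2.pos h1
      exact ⟨π, hπ, fun _ => hrun⟩
    · exact ⟨.output false, by simp [Protocol.cost], fun h => absurd h hp⟩
  choose π hcost hrun using hprot
  refine ⟨(PMF.uniformOfFinset R hne).map π, fun σ hσ => ?_, fun r l => ?_⟩
  · rw [PMF.support_map] at hσ
    obtain ⟨p, -, rfl⟩ := hσ
    exact hcost p
  · rw [PMF.toOuterMeasure_map_apply, PMF.toOuterMeasure_uniformOfFinset_apply]
    set z := r.1.2 - (l.1.1 * r.1.1 + l.1.2) with hz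
    have hbad : 3 * (R.filter fun p =>
        p ∈ π ⁻¹' {σ | σ.run r l ≠ pointLine S T r l}).card ≤ R.card := by
      by_cases hz0 : z = 0
      · rw [Finset.filter_eq_empty_iff.2]
        · simp
        · intro p hp
          have : r.1.2 = l.1.1 * r.1.1 + l.1.2 := by linarith
          simp [hrun p hp, pointLine, this]
      -- A prime errs only if it divides `z ≠ 0`; as `|z| < 2 ^ m`, fewer than `m` primes do.
      · have hsub : (R.filter fun p => p ∈ π ⁻¹' {σ | σ.run r l ≠ pointLine S T r l})
            ⊆ z.natAbs.primeFactors := by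
          intro p hp
          obtain ⟨hpR, hp⟩ := Finset.mem_filter.1 hp
          have h1 : r.1.2 ≠ l.1.1 * r.1.1 + l.1.2 := fun h => hz0 (by linarith)
          have h2 : (p : ℤ) ∣ z := by
            simpa [hrun p hpR, pointLine, h1] using hp
          exact Nat.mem_primeFactors.2 ⟨(Nat.mem_primesLE.1 hpR).2,
            Int.natCast_dvd.1 h2, Int.natAbs_ne_zero.2 hz0⟩
        have h1 := Finset.card_le_card hsub
        have h2 := two_pow_card_primeFactors_le (Int.natAbs_ne_zero.2 hz0)
        have h3 : z.natAbs < 2 ^ m := by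
          have := hST r.1 r.2 l.1 l.2
          rw [Int.abs_eq_natAbs] at this
          exact_mod_cast this
        have h4 := (Nat.pow_lt_pow_iff_right (a := 2) (by norm_num)).1 (h2.trans_lt h3)
        omega
    rw [ENNReal.div_le_iff (by simpa using hne.ne_empty) (by simp), mul_comm, ← mul_div_assoc,
      mul_one, ENNReal.le_div_iff_mul_le (by simp) (by simp), mul_comm]
    exact_mod_cast hbad

theorem publicCoinCC_pointLine_le {S T : Finset (ℤ × ℤ)} {n : ℕ} (hn : 1 ≤ n)
    (hS : S ⊆ pairs (-4 ^ n) (4 ^ n)) (hT : T ⊆ pairs (-4 ^ n) (4 ^ n)) :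
    (publicCoinCC (pointLine S T) : ℝ) ≤ 8 * Real.log n + 41 := by
  -- The discrepancy `y - (a * x + b)` is below `2 ^ (4 * n + 2)`, and `2 ^ j ≥ 16 * (n + 1)`
  -- exceeds the required `12 * n + 11`.
  set j := Nat.log 2 n + 5 with hj
  have h1 : n < 2 ^ (Nat.log 2 n + 1) := Nat.lt_pow_succ_log_self (by norm_num) _
  have h2 : 3 * (4 * n + 2) + 5 ≤ 2 ^ j := by
    have : 2 ^ j = 2 ^ (Nat.log 2 n + 1) * 16 := by rw [hj, pow_add, pow_add]; ring
    omega
  have h3 : publicCoinCC (pointLine S T) ≤ 4 * j + 1 := by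
    refine publicCoinCC_le (publicCoinComputes_pointLine h2 fun p hp l hl => ?_)
    obtain ⟨⟨p1, p2⟩, p3, p4⟩ := mem_pairs.1 (hS hp)
    obtain ⟨⟨l1, l2⟩, l3, l4⟩ := mem_pairs.1 (hT hl)
    have e : (2 : ℤ) ^ (4 * n + 2) = 4 * (4 ^ n * 4 ^ n) := by
      rw [← mul_pow, pow_add, pow_mul]; norm_num; ring
    have h4 : (4 : ℤ) ≤ 4 ^ n := by
      calc (4 : ℤ) = 4 ^ 1 := by norm_num
        _ ≤ 4 ^ n := pow_le_pow_right₀ (by norm_num) hn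
    have h5 : |l.1 * p.1| ≤ 4 ^ n * 4 ^ n := by
      rw [abs_mul]
      exact mul_le_mul (abs_le.2 ⟨l1, l2⟩) (abs_le.2 ⟨p1, p2⟩) (abs_nonneg _) (by positivity)
    obtain ⟨h6, h7⟩ := abs_le.1 h5
    rw [e]
    exact abs_lt.2 ⟨by nlinarith, by nlinarith⟩
  have h4 : (Nat.log 2 n : ℝ) * Real.log 2 ≤ Real.log n := by
    rw [← Real.log_pow]
    refine Real.log_le_log (by positivity) ?_
    exact_mod_cast Nat.pow_log_le_self 2 (by omega)
  have h5 : (publicCoinCC (pointLine S T) : ℝ) ≤ 4 * (Nat.log 2 n + 5) + 1 := by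
    exact_mod_cast h3
  have h6 : (Nat.log 2 n : ℝ) * (1 / 2) ≤ Nat.log 2 n * Real.log 2 := by
    gcongr
    linarith [Real.log_two_gt_d9]
  linarith

/-! ### Asymptotics. -/

theorem isTheta_log_of_bounds {u : ℕ → ℕ} (hlow : ∀ n : ℕ, 8 ≤ n → Real.log n ≤ 4 * u n + 15)
    (hup : ∀ n : ℕ, 1 ≤ n → (u n : ℝ) ≤ 8 * Real.log n + 41) :
    (fun n : ℕ => (u n : ℝ)) =Θ[atTop] fun n : ℕ => Real.log (n : ℝ) := by
  -- Beyond `41` the additive constants are absorbed: `8 * log n + 41 ≤ 9 * log n` and `15 ≤ log n /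
  -- 2`.
  have hlog : ∀ᶠ n : ℕ in atTop, 41 ≤ Real.log n :=
    (Real.tendsto_log_atTop.comp tendsto_natCast_atTop_atTop).eventually_ge_atTop 41
  constructor
  · refine IsBigO.of_bound 9 ?_
    filter_upwards [hlog, eventually_ge_atTop 1] with n h1 h2
    rw [Real.norm_of_nonneg (by positivity), Real.norm_of_nonneg (by linarith)]
    linarith [hup n h2]
  · refine IsBigO.of_bound 8 ?_
    filter_upwards [hlog, eventually_ge_atTop 8] with n h1 h2
    rw [Real.norm_of_nonneg (by linarith), Real.norm_of_nonneg (by positivity)]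
    linarith [hlow n h2]

theorem pairs_subset {u v u' v' : ℤ} (hu : u' ≤ u) (hv : v ≤ v') : pairs u v ⊆ pairs u' v' := by
  intro r hr
  simp only [mem_pairs] at hr ⊢
  omega

theorem theorem1 :
    ((fun n : ℕ => (publicCoinCC (PL n) : ℝ)) =Θ[atTop] fun n : ℕ => Real.log (n : ℝ)) ∧
    ((fun n : ℕ => (publicCoinCC (PLNat n) : ℝ)) =Θ[atTop] fun n : ℕ => Real.log (n : ℝ)) ∧
    ((fun n : ℕ => (publicCoinCC (PLSigned n) : ℝ)) =Θ[atTop] fun n : ℕ => Real.log (n : ℝ)) := by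
  have h1 : ∀ n : ℕ, (1 : ℤ) ≤ 2 ^ n := fun n => one_le_pow₀ (by norm_num)
  have h2 : ∀ n : ℕ, ((2 : ℤ) ^ n) ^ 2 = 4 ^ n := fun n => by rw [← pow_mul, mul_comm, pow_mul]; norm_num
  have h3 : ∀ n : ℕ, (2 : ℤ) ^ n ≤ 4 ^ n := fun n => by rw [← h2]; nlinarith [h1 n]
  refine ⟨isTheta_log_of_bounds (fun n hn => ?_) (fun n hn => ?_),
    isTheta_log_of_bounds (fun n hn => ?_) (fun n hn => ?_),
    isTheta_log_of_bounds (fun n hn => ?_) (fun n hn => ?_)⟩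
  · exact log_le_of_PLNat hn (PLNat_of_PL (publicCoinComputes_publicCoinCC _))
  · exact publicCoinCC_pointLine_le hn
      (pairs_subset (by linarith [h1 n, h3 n]) (h3 n))
      (pairs_subset (by rw [h2]) (by rw [h2]))
  · exact log_le_of_PLNat hn (publicCoinComputes_publicCoinCC _)
  · exact publicCoinCC_pointLine_le hn
      (pairs_subset (by linarith [h1 n, h3 n]) (by linarith [h3 n]))
      (pairs_subset (by linarith [h1 n, h3 n]) (by linarith [h3 n]))
  · exact log_le_of_PLNat hn (PLNat_of_PLSigned (publicCoinComputes_publicCoinCC _))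
  · exact publicCoinCC_pointLine_le hn
      (pairs_subset (by linarith [h1 n, h3 n]) (by linarith [h3 n]))
      (pairs_subset (by linarith [h1 n, h3 n]) (by linarith [h3 n]))
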